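/- **Fairness error bound (VC version).** Let $\mathcal X,\mathcal Y$ be measurable spaces, $\mathcal F$ a class of functions $\mathcal X\to\mathcal Y$, $\ell:\mathcal Y\times\mathcal Y\to[0,M]$ a bounded loss, $\mathcal A$ a finite set of groups, and for each $a\in\mathcal A$ let $\mathcal D_a$ be a probability distribution on $\mathcal X\times\mathcal Y$. Write $\ell\circ\mathcal F=\{(x,y)\mapsto \ell(f(x),y): f\in\mathcal F\}$. Suppose that $\ell\circ\mathcal F$ is a measurable class for every $\mathcal D_a$: its members are measurable, and for all $m$ and $e\in\mathbb R^m$ the map $(z_1,\dots,z_m)\mapsto\sup_{g\in\ell\circ\mathcal F}\bigl|\sum_{i=1}^m e_i g(z_i)\bigr|$ is measurable with respect to the completion of $\mathcal D_a^{\otimes m}$. Let $d<\infty$ be the VC dimension, in one of the following two senses: either $d$ is the VC dimension of the real-valued class $\ell\circ\mathcal F$, that is, the largest cardinality of a finite subset of $(\mathcal X\times\mathcal Y)\times\mathbb R$ shattered by the subgraphs $\{(z,t): t<g(z)\}$, $g\in\ell\circ\mathcal F$; or $\mathcal Y=\{y_0,y_1\}$ has exactly two elements and $d$ is the classical VC dimension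 of $\mathcal F$, that is, of the family of sets $\{x: f(x)=y_1\}$, $f\in\mathcal F$. Let $n\ge 1$ be an integer with $d\le 2n$, let $\delta>0$, and for each $a\in\mathcal A$ let $(x^a_1,y^a_1),\dots,(x^a_n,y^a_n)$ be an i.i.d. sample from $\mathcal D_a$ (all samples are defined on one probability space; no independence between different groups is needed). Then, with probability at least $1-\delta$, simultaneously for all $f\in\mathcal F$ and all $a,b\in\mathcal A$, $$\Bigl|\mathbb E_{(x,y)\sim\mathcal D_a}[\ell(f(x),y)]-\mathbb E_{(x,y)\sim\mathcal D_b}[\ell(f(x),y)]\Bigr|\le\Bigl|\frac1n\sum_{k=1}^n\ell(f(x^a_k),y^a_k)-\frac1n\sum_{k=1}^n\ell(f(x^b_k),y^b_k)\Bigr|+2M\sqrt{\frac{2d\log(2en/d)+\log(8|\mathcal A|^2/\delta)}{n}},$$ where $d\log(2en/d)$ is read as $0$ when $d=0$. ("With probability at least $1-\delta$" means that the inequalities hold on a measurable event of probability at least $1-\delta$.) -/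

import Mathlib

open MeasureTheory ProbabilityTheory

noncomputable section

namespace FairnessVC

/-- The family of sets `C` shatters the finite set `S`: every subset `T` of `S` is cut out of `S`
by a member of `C`. -/
def Shatters {Z : Type*} (C : Set (Set Z)) (S : Finset Z) : Prop :=
  ∀ T ⊆ S, ∃ B ∈ C, ∀ z ∈ S, z ∈ B ↔ z ∈ T

/-- Vapnik-Chervonenkis dimension of a family of sets: the supremum of the cardinalities of the
finite sets it shatters. -/
def vcDim {Z : Type*} (C : Set (Set Z)) : ℕ∞ :=
  ⨆ (S : Finset Z) (_ : Shatters C S), (S.card : ℕ∞)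

/-- The subgraphs `{(z, t) | t < g z}` of the functions in a class of real-valued functions. -/
def subgraphs {Z : Type*} (G : Set (Z → ℝ)) : Set (Set (Z × ℝ)) :=
  (fun g => {p : Z × ℝ | p.2 < g p.1}) '' G

/-- Vapnik-Chervonenkis dimension of a class of real-valued functions, i.e. the VC dimension of
its family of subgraphs (for indicator functions, that of the sets they indicate). -/
def funVCDim {Z : Type*} (G : Set (Z → ℝ)) : ℕ∞ :=
  vcDim (subgraphs G)

/-- The composed class `ℓ ∘ F = {(x, y) ↦ ℓ (f x, y) : f ∈ F}`. -/
def lossClass {X Y : Type*} (ℓ : Y → Y → ℝ) (F : Set (X → Y)) : Set (X × Y → ℝ) :=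
  (fun f z => ℓ (f z.1) z.2) '' F

/-- `G` is a measurable class for the law `P`: its members are measurable, and for every `m` and
all real weights `e₁, …, e_m` the function `(z₁, …, z_m) ↦ sup_{g ∈ G} |∑ i, e_i * g (z_i)|` is
measurable for the completion of `P ^ m`.
The supremum is finite for the uniformly bounded classes considered here. -/
def IsMeasurableClass {Z : Type*} [MeasurableSpace Z] (P : Measure Z) (G : Set (Z → ℝ)) : Prop :=
  (∀ g ∈ G, Measurable g) ∧
    ∀ (m : ℕ) (e : Fin m → ℝ),
      AEMeasurable (fun z : Fin m → Z => ⨆ g : G, |∑ i, e i * g.1 (z i)|)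
        (Measure.pi fun _ : Fin m => P)

/-- The expected loss of `f` under the data distribution `P`. -/
def risk {X Y : Type*} [MeasurableSpace X] [MeasurableSpace Y]
    (ℓ : Y → Y → ℝ) (P : Measure (X × Y)) (f : X → Y) : ℝ :=
  ∫ z, ℓ (f z.1) z.2 ∂P

/-- The average loss of `f` on the sample `s₁, …, s_n`. -/
def empRisk {X Y : Type*} (ℓ : Y → Y → ℝ) {n : ℕ} (s : Fin n → X × Y) (f : X → Y) : ℝ :=
  (1 / (n : ℝ)) * ∑ k, ℓ (f (s k).1) (s k).2

end FairnessVC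

end

namespace FairnessVC

/-! ### Growth function bounds -/

/-! It suffices to control each group separately: if every empirical risk is within `ε` of the true
risk, uniformly over the class, two triangle inequalities cost `2ε`. A union bound over the `|A|`
groups needs no independence between them.

The uniform bound for one group is a Vapnik-Chervonenkis inequality with failure probability `8 Φ
exp (-n (ε/M)²)`, where `Φ = (2en/d)^d` bounds the traces on `2n` points (Sauer-Shelah). To reach
this exponent, the ghost sample is introduced by Jensen's inequality inside an exponential moment,
so that `ε` is not halved, and the `2n` points are symmetrized by all permutations instead of
pairwise swaps. For fixed points what remains is a sum of balanced signs drawn without replacement,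
and Serfling's inequality gives the moment factor `exp (t²(n+1)/4)`, where independent random signs
on the pairs would give `exp (t²n/2)`.

Real-valued functions reduce to sets by writing `v = M ∫₀¹ 1{Mu < v} du` and applying Jensen once
more: only traces at a common level are ever counted. `sum_perm_exp_sum_sign_le`,
`sum_perm_exp_abs_sum_mul_le` and `exists_measurableSet_deviation` carry the argument. -/

lemma sum_choose_le_exp_mul_div_pow {N d : ℕ} (hd : d ≤ N) :
    ((∑ k ∈ Finset.range (d + 1), N.choose k : ℕ) : ℝ) ≤ (Real.exp 1 * N / d) ^ d := by
  rcases Nat.eq_zero_or_pos d with rfl | hd0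
  · simp
  have hN : (0 : ℝ) < N := by exact_mod_cast hd0.trans_le hd
  have hdR : (0 : ℝ) < d := by exact_mod_cast hd0
  set x : ℝ := d / N with hx
  have hx0 : 0 < x := by positivity
  have hx1 : x ≤ 1 := (div_le_one hN).2 (by exact_mod_cast hd)
  -- Weighting by powers of `x = d/N ≤ 1` turns the partial sum into part of the binomial expansion
  -- of `(1 + x)^N ≤ exp (N x)`.
  have key : (∑ k ∈ Finset.range (d + 1), (N.choose k : ℝ)) * x ^ d ≤ Real.exp d := by
    calc (∑ k ∈ Finset.range (d + 1), (N.choose k : ℝ)) * x ^ d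
        = ∑ k ∈ Finset.range (d + 1), x ^ d * N.choose k := by
          rw [Finset.sum_mul]; exact Finset.sum_congr rfl fun _ _ => mul_comm _ _
      _ ≤ ∑ k ∈ Finset.range (d + 1), x ^ k * N.choose k := by
          refine Finset.sum_le_sum fun k hk => ?_
          have hkd : k ≤ d := Nat.lt_succ_iff.1 (Finset.mem_range.1 hk)
          exact mul_le_mul_of_nonneg_right (pow_le_pow_of_le_one hx0.le hx1 hkd) (by positivity)
      _ ≤ ∑ k ∈ Finset.range (N + 1), x ^ k * N.choose k := by
          refine Finset.sum_le_sum_of_subset_of_nonneg ?_ fun _ _ _ => by positivity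
          exact Finset.range_subset_range.2 (by omega)
      _ = (x + 1) ^ N := by rw [add_pow]; simp
      _ ≤ Real.exp x ^ N := pow_le_pow_left₀ (by positivity) (Real.add_one_le_exp x) N
      _ = Real.exp d := by rw [← Real.exp_nat_mul, hx]; congr 1; field_simp
  push_cast
  rw [← le_div_iff₀ (by positivity)] at key
  refine key.trans_eq ?_
  rw [hx, mul_div_assoc, mul_pow, ← Real.exp_nat_mul, mul_one, div_pow, div_pow]
  field_simp

/-- **Sauer-Shelah lemma** for the traces of a family of sets on an indexed family of points. -/
lemma card_le_sum_choose_of_vcDim_le {Z ι : Type*} [Fintype ι] [DecidableEq ι]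
    {C : Set (Set Z)} {d : ℕ} (hC : vcDim C ≤ d) (p : ι → Z) (𝒜 : Finset (Finset ι))
    (h𝒜 : ∀ a ∈ 𝒜, ∃ B ∈ C, ∀ i, i ∈ a ↔ p i ∈ B) :
    𝒜.card ≤ ∑ k ∈ Finset.range (d + 1), (Fintype.card ι).choose k := by
  classical
  have hvc : 𝒜.vcDim ≤ d := by
    refine Finset.sup_le fun s hs => ?_
    rw [Finset.mem_shatterer] at hs
    -- The points may repeat, but no set separates two indices carrying the same point, so a
    -- shattered index set has distinct points.
    have hinj : Set.InjOn p s := by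
      intro i hi j hj hij
      obtain ⟨u, hu, hui⟩ := hs (Finset.singleton_subset_iff.2 hi)
      obtain ⟨B, -, hB⟩ := h𝒜 u hu
      have hiu : i ∈ u := (Finset.mem_inter.1 (hui ▸ Finset.mem_singleton_self i)).2
      have hju : j ∈ u := (hB j).2 (hij ▸ (hB i).1 hiu)
      have : j ∈ s ∩ u := Finset.mem_inter.2 ⟨hj, hju⟩
      rw [hui, Finset.mem_singleton] at this
      exact this.symm
    have hsh : Shatters C (s.image p) := by
      intro T hT
      obtain ⟨u, hu, hui⟩ := hs (Finset.filter_subset (fun i => p i ∈ T) s)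
      obtain ⟨B, hBC, hB⟩ := h𝒜 u hu
      refine ⟨B, hBC, fun z hz => ?_⟩
      obtain ⟨i, hi, rfl⟩ := Finset.mem_image.1 hz
      rw [← hB i]
      have := Finset.ext_iff.1 hui i
      simpa [hi] using this
    have h1 : ((s.image p).card : ℕ∞) ≤ d :=
      (le_iSup₂ (f := fun (S : Finset Z) (_ : Shatters C S) => (S.card : ℕ∞)) _ hsh).trans hC
    rw [Finset.card_image_of_injOn hinj] at h1
    exact_mod_cast h1
  calc 𝒜.card ≤ 𝒜.shatterer.card := 𝒜.card_le_card_shatterer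
    _ ≤ ∑ k ∈ Finset.Iic 𝒜.vcDim, (Fintype.card ι).choose k := Finset.card_shatterer_le_sum_vcDim
    _ ≤ _ := Finset.sum_le_sum_of_subset fun k hk => by
      rw [Finset.mem_Iic] at hk
      exact Finset.mem_range.2 (by omega)

/-! ### Exponential moments of balanced signs under random permutations -/

/-- The left side is the moment generating function of a `±1` variable with mean `m`, so this is
Hoeffding's lemma for the two-point law `ν`. -/
lemma cosh_add_mul_sinh_le_exp {m : ℝ} (hm : m ∈ Set.Icc (-1 : ℝ) 1) (t : ℝ) :
    Real.cosh t + m * Real.sinh t ≤ Real.exp (t * m + t ^ 2 / 2) := by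
  set p : ℝ := (1 + m) / 2 with hp
  set q : ℝ := (1 - m) / 2 with hq
  have hp0 : 0 ≤ p := by rw [hp]; linarith [hm.1]
  have hq0 : 0 ≤ q := by rw [hq]; linarith [hm.2]
  set ν : Measure ℝ := ENNReal.ofReal p • Measure.dirac 1 + ENNReal.ofReal q • Measure.dirac (-1)
    with hν
  have hI (f : ℝ → ℝ) : ∫ x, f x ∂ν = p * f 1 + q * f (-1) := by
    rw [hν, integral_add_measure, integral_smul_measure, integral_smul_measure]
    · simp [hp0, hq0]
    · exact (integrable_dirac (by simp)).smul_measure ENNReal.ofReal_ne_top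
    · exact (integrable_dirac (by simp)).smul_measure ENNReal.ofReal_ne_top
  have : IsProbabilityMeasure ν := ⟨by
    simp only [hν, Measure.coe_add, Measure.coe_smul, Pi.add_apply, Pi.smul_apply, smul_eq_mul,
      measure_univ, mul_one]
    rw [← ENNReal.ofReal_add hp0 hq0, hp, hq]; ring_nf; simp⟩
  have hae : ∀ᵐ x ∂ν, x ∈ Set.Icc (-1 : ℝ) 1 := by
    rw [hν, ae_add_measure_iff]
    constructor <;>
    · refine Measure.ae_smul_measure ?_ _
      rw [ae_dirac_eq]
      norm_num
  have h := (hasSubgaussianMGF_of_mem_Icc (X := fun x : ℝ => x) aemeasurable_id hae).mgf_le t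
  have hmean : ∫ x, x ∂ν = m := by rw [hI]; rw [hp, hq]; ring
  rw [mgf, hI, hmean] at h
  have e1 : Real.exp (t * (1 - m)) = Real.exp t * Real.exp (-(t * m)) := by
    rw [← Real.exp_add]; ring_nf
  have e2 : Real.exp (t * (-1 - m)) = Real.exp (-t) * Real.exp (-(t * m)) := by
    rw [← Real.exp_add]; ring_nf
  have e3 : (((‖(1 : ℝ) - -1‖₊ / 2) ^ 2 : NNReal) : ℝ) * t ^ 2 / 2 = t ^ 2 / 2 := by
    push_cast; norm_num
  rw [e1, e2, e3] at h
  rw [Real.exp_add, Real.cosh_eq, Real.sinh_eq]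
  have hpos := Real.exp_pos (t * m)
  have hcancel : Real.exp (t * m) * Real.exp (-(t * m)) = 1 := by rw [← Real.exp_add]; simp
  have := mul_le_mul_of_nonneg_left h hpos.le
  calc (Real.exp t + Real.exp (-t)) / 2 + m * ((Real.exp t - Real.exp (-t)) / 2)
      = (Real.exp (t * m) * Real.exp (-(t * m))) * (p * Real.exp t + q * Real.exp (-t)) := by
        rw [hcancel, hp, hq]; ring
    _ = Real.exp (t * m) * (p * (Real.exp t * Real.exp (-(t * m))) +
          q * (Real.exp (-t) * Real.exp (-(t * m)))) := by ring
    _ ≤ _ := this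

lemma sum_exp_mul_sign_le {κ : Type*} (U : Finset κ) (hU : U.Nonempty) (s : κ → ℝ)
    (hs : ∀ i, s i = 1 ∨ s i = -1) (t : ℝ) :
    ∑ i ∈ U, Real.exp (t * s i) ≤
      U.card * Real.exp (t * ((∑ i ∈ U, s i) / U.card) + t ^ 2 / 2) := by
  have hc : (0 : ℝ) < U.card := by exact_mod_cast hU.card_pos
  have hm : (∑ i ∈ U, s i) / U.card ∈ Set.Icc (-1 : ℝ) 1 := by
    have h : |∑ i ∈ U, s i| ≤ U.card := by
      refine (Finset.abs_sum_le_sum_abs _ _).trans ?_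
      refine (Finset.sum_le_card_nsmul U _ 1 fun i _ => ?_).trans (by simp)
      rcases hs i with h | h <;> simp [h]
    rw [Set.mem_Icc, ← abs_le, abs_div, abs_of_pos hc]
    exact (div_le_one hc).2 h
  refine le_trans (le_of_eq ?_)
    (mul_le_mul_of_nonneg_left (cosh_add_mul_sinh_le_exp hm t) hc.le)
  have : ∀ i ∈ U, Real.exp (t * s i) = Real.cosh t + s i * Real.sinh t := by
    intro i _
    rcases hs i with h | h <;> rw [h]
    · rw [mul_one, one_mul, Real.cosh_add_sinh]
    · rw [Real.cosh_eq, Real.sinh_eq]; ring_nf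
  rw [Finset.sum_congr rfl this, Finset.sum_add_distrib, ← Finset.sum_mul]
  simp only [Finset.sum_const, nsmul_eq_mul]
  field_simp

/-- **Serfling's inequality** for sampling balanced signs without replacement. -/
lemma sum_perm_exp_sum_sign_le {ι : Type*} [Fintype ι] [DecidableEq ι] (s : ι → ℝ)
    (hs : ∀ i, s i = 1 ∨ s i = -1) (h0 : ∑ i, s i = 0) (B : Finset ι) :
    ∀ t : ℝ, ∑ σ : Equiv.Perm ι, Real.exp (t * ∑ i ∈ B, s (σ i)) ≤
      (Fintype.card ι).factorial * Real.exp (t ^ 2 / 2 *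
        (B.card * (Fintype.card ι - B.card + 1) / Fintype.card ι)) := by
  induction B using Finset.induction_on with
  | empty => intro t; simp [Fintype.card_perm]
  | insert a B ha ih =>
    intro t
    set N : ℝ := ((Fintype.card ι : ℕ) : ℝ) with hN
    set k : ℝ := ((B.card : ℕ) : ℝ) with hk
    set r : ℝ := (Bᶜ.card : ℝ) with hr
    have hne : (Bᶜ).Nonempty := ⟨a, by simpa using ha⟩
    have hr1 : 1 ≤ r := by rw [hr]; exact_mod_cast hne.card_pos
    have hkN : k + r = N := by rw [hk, hr, hN]; exact_mod_cast B.card_add_card_compl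
    have hk0 : 0 ≤ k := by positivity
    -- All indices outside `B` are exchangeable, so the new draw can be averaged over `Bᶜ`.
    have hswap : ∀ b ∈ Bᶜ, ∑ σ : Equiv.Perm ι,
        Real.exp (t * (s (σ b) + ∑ i ∈ B, s (σ i))) =
        ∑ σ : Equiv.Perm ι, Real.exp (t * (s (σ a) + ∑ i ∈ B, s (σ i))) := by
      intro b hb
      rw [← Equiv.sum_comp (Equiv.mulRight (Equiv.swap a b))]
      refine Finset.sum_congr rfl fun σ _ => ?_
      have : ∑ i ∈ B, s ((σ * Equiv.swap a b) i) = ∑ i ∈ B, s (σ i) := by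
        refine Finset.sum_congr rfl fun i hi => ?_
        rw [Equiv.Perm.mul_apply, Equiv.swap_apply_of_ne_of_ne]
        · rintro rfl; exact ha hi
        · rintro rfl; exact (Finset.mem_compl.1 hb) hi
      rw [Equiv.coe_mulRight, this]
      simp
    have havg : r * ∑ σ : Equiv.Perm ι, Real.exp (t * (s (σ a) + ∑ i ∈ B, s (σ i))) =
        ∑ σ : Equiv.Perm ι, Real.exp (t * ∑ i ∈ B, s (σ i)) *
          ∑ b ∈ Bᶜ, Real.exp (t * s (σ b)) := by
      rw [hr, ← nsmul_eq_mul, ← Finset.sum_const, ← Finset.sum_congr rfl hswap, Finset.sum_comm]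
      refine Finset.sum_congr rfl fun σ _ => ?_
      rw [Finset.mul_sum]
      refine Finset.sum_congr rfl fun b _ => ?_
      rw [← Real.exp_add]; ring_nf
    have hstep : r * ∑ σ : Equiv.Perm ι, Real.exp (t * (s (σ a) + ∑ i ∈ B, s (σ i))) ≤
        r * (Real.exp (t ^ 2 / 2) *
          ∑ σ : Equiv.Perm ι, Real.exp ((t * (1 - 1 / r)) * ∑ i ∈ B, s (σ i))) := by
      rw [havg, ← mul_assoc, Finset.mul_sum]
      refine Finset.sum_le_sum fun σ _ => ?_
      have h1 := sum_exp_mul_sign_le Bᶜ hne (fun i => s (σ i)) (fun i => hs _) t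
      -- By balance, the undrawn signs have mean `-S/r`, with `S` the sum already drawn. This pull
      -- towards zero shrinks `t` to `t (1 - 1/r)`, which is why the induction hypothesis must hold
      -- for every `t`.
      have h2 : ∑ i ∈ Bᶜ, s (σ i) = -∑ i ∈ B, s (σ i) := by
        have := Finset.sum_add_sum_compl B fun i => s (σ i)
        rw [Equiv.sum_comp σ s, h0] at this
        linarith
      rw [h2] at h1
      refine (mul_le_mul_of_nonneg_left h1 (Real.exp_pos _).le).trans_eq ?_
      rw [← hr, mul_left_comm, ← Real.exp_add, mul_assoc, ← Real.exp_add]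
      congr 2
      field_simp
      ring
    have hstep' := le_of_mul_le_mul_left hstep (by linarith)
    have hcard : ((insert a B).card : ℝ) = k + 1 := by
      rw [Finset.card_insert_of_notMem ha]; push_cast; rfl
    simp_rw [Finset.sum_insert ha]
    refine hstep'.trans ?_
    refine (mul_le_mul_of_nonneg_left (ih _) (Real.exp_pos _).le).trans ?_
    rw [mul_left_comm, ← Real.exp_add, hcard, ← hkN]
    refine mul_le_mul_of_nonneg_left (Real.exp_le_exp.2 ?_) (by positivity)
    have hr0 : 0 < r := by linarith
    have hN0 : 0 < k + r := by linarith
    have hcore : 1 + (1 - 1 / r) ^ 2 * (k * (r + 1) / (k + r)) ≤ (k + 1) * r / (k + r) := by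
      have : (k + 1) * r / (k + r) - (1 + (1 - 1 / r) ^ 2 * (k * (r + 1) / (k + r))) =
          k * (r - 1) / (r ^ 2 * (k + r)) := by
        field_simp
        ring
      have h3 : 0 ≤ k * (r - 1) / (r ^ 2 * (k + r)) := by
        have : 0 ≤ r - 1 := by linarith
        positivity
      linarith
    calc t ^ 2 / 2 + (t * (1 - 1 / r)) ^ 2 / 2 * (k * (k + r - k + 1) / (k + r))
        = t ^ 2 / 2 * (1 + (1 - 1 / r) ^ 2 * (k * (r + 1) / (k + r))) := by ring
      _ ≤ t ^ 2 / 2 * ((k + 1) * r / (k + r)) := by gcongr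
      _ = t ^ 2 / 2 * ((k + 1) * (k + r - (k + 1) + 1) / (k + r)) := by ring

lemma sum_perm_exp_abs_sum_sign_le {ι : Type*} [Fintype ι] [DecidableEq ι] (s : ι → ℝ)
    (hs : ∀ i, s i = 1 ∨ s i = -1) (h0 : ∑ i, s i = 0) {n : ℕ} (hn : 0 < n)
    (hcard : Fintype.card ι = 2 * n) (B : Finset ι) (t : ℝ) :
    ∑ σ : Equiv.Perm ι, Real.exp (t * |∑ i ∈ B, s (σ i)|) ≤
      2 * ((Fintype.card ι).factorial * Real.exp (t ^ 2 * (n + 1) / 4)) := by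
  have hbound (t : ℝ) : ∑ σ : Equiv.Perm ι, Real.exp (t * ∑ i ∈ B, s (σ i)) ≤
      (Fintype.card ι).factorial * Real.exp (t ^ 2 * (n + 1) / 4) := by
    refine (sum_perm_exp_sum_sign_le s hs h0 B t).trans ?_
    refine mul_le_mul_of_nonneg_left (Real.exp_le_exp.2 ?_) (by positivity)
    have hn' : (0 : ℝ) < n := by exact_mod_cast hn
    rw [hcard]
    push_cast
    -- The maximum over integers is at `n` and `n + 1`; over the reals it would be `(n + 1/2)²`,
    -- hence the case split.
    have hk : (B.card : ℝ) * (2 * n - B.card + 1) ≤ n * (n + 1) := by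
      rcases le_or_gt B.card n with h | h
      · have h1 : (B.card : ℝ) ≤ n := by exact_mod_cast h
        nlinarith
      · have h1 : (n : ℝ) + 1 ≤ B.card := by exact_mod_cast h
        nlinarith
    have : (B.card : ℝ) * (2 * n - B.card + 1) / (2 * n) ≤ (n + 1) / 2 := by
      rw [div_le_div_iff₀ (by positivity) (by norm_num)]
      linarith
    calc t ^ 2 / 2 * ((B.card : ℝ) * (2 * n - B.card + 1) / (2 * n))
        ≤ t ^ 2 / 2 * ((n + 1) / 2) := by gcongr
      _ = _ := by ring
  calc ∑ σ : Equiv.Perm ι, Real.exp (t * |∑ i ∈ B, s (σ i)|)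
      ≤ ∑ σ : Equiv.Perm ι, (Real.exp (t * ∑ i ∈ B, s (σ i)) +
          Real.exp (-t * ∑ i ∈ B, s (σ i))) := by
        refine Finset.sum_le_sum fun σ _ => ?_
        rcases abs_choice (∑ i ∈ B, s (σ i)) with h | h <;> rw [h]
        · linarith [Real.exp_pos (-t * ∑ i ∈ B, s (σ i))]
        · rw [mul_neg, ← neg_mul]
          linarith [Real.exp_pos (t * ∑ i ∈ B, s (σ i))]
    _ ≤ _ := by
        rw [Finset.sum_add_distrib, two_mul]
        refine add_le_add (hbound t) ?_
        simpa using hbound (-t)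

/-! ### Exponential moments of vectors with few level traces -/

lemma exp_mul_abs_integral_le {α : Type*} [MeasurableSpace α] {ν : Measure α}
    [IsProbabilityMeasure ν] {X : α → ℝ} (hX : AEMeasurable X ν) {c : ℝ} (hc : ∀ x, |X x| ≤ c)
    {t : ℝ} (ht : 0 ≤ t) :
    Integrable (fun x => Real.exp (t * |X x|)) ν ∧
      Real.exp (t * |∫ x, X x ∂ν|) ≤ ∫ x, Real.exp (t * |X x|) ∂ν := by
  have h1 : Integrable (fun x => t * |X x|) ν :=
    ((Integrable.of_bound hX.aestronglyMeasurable c (ae_of_all _ hc)).abs).const_mul t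
  have h2 : Integrable (fun x => Real.exp (t * |X x|)) ν := by
    refine Integrable.of_bound (C := Real.exp (t * c)) ?_ (ae_of_all _ fun x => ?_)
    · exact (Real.measurable_exp.comp_aemeasurable h1.aemeasurable).aestronglyMeasurable
    · rw [Real.norm_eq_abs, Real.abs_exp]
      exact Real.exp_le_exp.2 (mul_le_mul_of_nonneg_left (hc x) ht)
  refine ⟨h2, ?_⟩
  calc Real.exp (t * |∫ x, X x ∂ν|) ≤ Real.exp (∫ x, t * |X x| ∂ν) := by
        rw [integral_const_mul]
        exact Real.exp_le_exp.2 (mul_le_mul_of_nonneg_left abs_integral_le_integral_abs ht)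
    _ ≤ ∫ x, Real.exp (t * |X x|) ∂ν :=
        convexOn_exp.map_integral_le Real.continuous_exp.continuousOn isClosed_univ (by simp) h1 h2

/-- A bound for the number of traces at any level carries over, by integration over the level, to
exponential moments of signed sums of the vectors themselves. -/
lemma sum_perm_exp_abs_sum_mul_le {ι : Type*} [Fintype ι] [DecidableEq ι] (s : ι → ℝ)
    (hs : ∀ i, s i = 1 ∨ s i = -1) (h0 : ∑ i, s i = 0) {n : ℕ} (hn : 0 < n)
    (hcard : Fintype.card ι = 2 * n) {M : ℝ} (hM : 0 < M) (V : Set (ι → ℝ))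
    (hV : ∀ v ∈ V, ∀ i, v i ∈ Set.Icc 0 M) (Φ : ℝ)
    (hΦ : ∀ (T : ℝ) (𝒜 : Finset (Finset ι)), (∀ a ∈ 𝒜, ∃ v ∈ V, ∀ i, i ∈ a ↔ T < v i) →
      (𝒜.card : ℝ) ≤ Φ)
    (v : Equiv.Perm ι → ι → ℝ) (hv : ∀ σ, v σ ∈ V) {t : ℝ} (ht : 0 ≤ t) :
    ∑ σ : Equiv.Perm ι, Real.exp (t * |∑ i, s (σ i) * v σ i|) ≤
      Φ * (2 * ((Fintype.card ι).factorial * Real.exp ((t * M) ^ 2 * (n + 1) / 4))) := by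
  classical
  set ν : Measure ℝ := volume.restrict (Set.Ico (0 : ℝ) 1) with hν
  have hprob : IsProbabilityMeasure ν := ⟨by simp [hν]⟩
  set X : Equiv.Perm ι → ℝ → ℝ := fun σ u => ∑ i, s (σ i) * (if M * u < v σ i then 1 else 0)
    with hXdef
  have hset (c : ℝ) : MeasurableSet {u : ℝ | M * u < c} :=
    measurableSet_lt (by fun_prop) measurable_const
  have hXm (σ) : Measurable (X σ) :=
    Finset.measurable_fun_sum _ fun i _ =>
      (Measurable.ite (hset _) measurable_const measurable_const).const_mul _
  have hXb (σ) (u : ℝ) : |X σ u| ≤ Fintype.card ι := by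
    refine (Finset.abs_sum_le_sum_abs _ _).trans ?_
    refine (Finset.sum_le_card_nsmul _ _ 1 fun i _ => ?_).trans (by simp)
    rcases hs (σ i) with h | h <;> rw [h] <;> split_ifs <;> simp
  -- Layer-cake formula: the level `M * u`, with `u` uniform on `[0, 1)`, lies below `v σ i` with
  -- probability `v σ i / M`.
  have hint (σ) : ∑ i, s (σ i) * v σ i = M * ∫ u, X σ u ∂ν := by
    rw [hXdef, integral_finsetSum, Finset.mul_sum]
    · refine Finset.sum_congr rfl fun i _ => ?_
      rw [integral_const_mul, mul_left_comm]
      congr 1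
      have hvi := hV _ (hv σ) i
      have : (fun u : ℝ => if M * u < v σ i then (1 : ℝ) else 0) =
          Set.indicator {u : ℝ | M * u < v σ i} 1 := by
        ext u; simp [Set.indicator_apply]
      rw [this, integral_indicator_one (hset _), hν, measureReal_restrict_apply (hset _)]
      have : {u : ℝ | M * u < v σ i} ∩ Set.Ico 0 1 = Set.Ico 0 (v σ i / M) := by
        ext u
        simp only [Set.mem_inter_iff, Set.mem_ofPred_eq, Set.mem_Ico, lt_div_iff₀ hM]
        constructor
        · rintro ⟨h1, h2, h3⟩; exact ⟨h2, by linarith⟩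
        · rintro ⟨h1, h2⟩
          refine ⟨by linarith, h1, ?_⟩
          nlinarith [hvi.2]
      rw [this, Real.volume_real_Ico_of_le (div_nonneg hvi.1 hM.le), sub_zero]
      field_simp
    · intro i _
      refine Integrable.of_bound (C := 1) ?_ (ae_of_all _ fun u => ?_)
      · exact ((Measurable.ite (hset _) measurable_const
          measurable_const).const_mul _).aestronglyMeasurable
      · rcases hs (σ i) with h | h <;> rw [h] <;> split_ifs <;> simp
  have hJ (σ) := exp_mul_abs_integral_le (ν := ν) (hXm σ).aemeasurable (hXb σ)
    (mul_nonneg ht hM.le)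
  calc ∑ σ : Equiv.Perm ι, Real.exp (t * |∑ i, s (σ i) * v σ i|)
      ≤ ∑ σ : Equiv.Perm ι, ∫ u, Real.exp (t * M * |X σ u|) ∂ν := by
        refine Finset.sum_le_sum fun σ _ => ?_
        rw [hint, abs_mul, abs_of_pos hM, ← mul_assoc]
        exact (hJ σ).2
    _ = ∫ u, ∑ σ : Equiv.Perm ι, Real.exp (t * M * |X σ u|) ∂ν :=
        (integral_finsetSum _ fun σ _ => (hJ σ).1).symm
    _ ≤ ∫ u, Φ * (2 * ((Fintype.card ι).factorial *
          Real.exp ((t * M) ^ 2 * (n + 1) / 4))) ∂ν := by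
        refine integral_mono (integrable_finsetSum _ fun σ _ => (hJ σ).1) (integrable_const _)
          fun u => ?_
        set a : Equiv.Perm ι → Finset ι := fun σ => Finset.univ.filter fun i => M * u < v σ i
          with ha
        have hXa (σ) : X σ u = ∑ i ∈ a σ, s (σ i) := by
          simp [hXdef, ha, Finset.sum_filter]
        have hA : ((Finset.univ.image a).card : ℝ) ≤ Φ := by
          refine hΦ (M * u) _ fun b hb => ?_
          obtain ⟨σ, -, rfl⟩ := Finset.mem_image.1 hb
          exact ⟨v σ, hv σ, fun i => by simp [ha]⟩
        -- Summing over all traces that occur removes the dependence of the trace on `σ`, so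
        -- Serfling applies to each fixed set.
        calc ∑ σ : Equiv.Perm ι, Real.exp (t * M * |X σ u|)
            ≤ ∑ σ : Equiv.Perm ι, ∑ b ∈ Finset.univ.image a,
                Real.exp (t * M * |∑ i ∈ b, s (σ i)|) := by
              refine Finset.sum_le_sum fun σ _ => ?_
              rw [hXa]
              exact Finset.single_le_sum (f := fun b => Real.exp (t * M * |∑ i ∈ b, s (σ i)|))
                (fun _ _ => (Real.exp_pos _).le) (Finset.mem_image_of_mem a (Finset.mem_univ σ))
          _ = ∑ b ∈ Finset.univ.image a, ∑ σ : Equiv.Perm ι,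
                Real.exp (t * M * |∑ i ∈ b, s (σ i)|) := Finset.sum_comm
          _ ≤ ((Finset.univ.image a).card : ℝ) * (2 * ((Fintype.card ι).factorial *
                Real.exp ((t * M) ^ 2 * (n + 1) / 4))) := by
              rw [← nsmul_eq_mul]
              exact Finset.sum_le_card_nsmul _ _ _ fun b _ =>
                sum_perm_exp_abs_sum_sign_le s hs h0 hn hcard b _
          _ ≤ _ := mul_le_mul_of_nonneg_right hA (by positivity)
    _ = _ := by simp

/-! ### Symmetrization -/

lemma measurePreserving_pi_comp_equiv {κ ι Z : Type*} [Fintype κ] [Fintype ι] [MeasurableSpace Z]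
    (P : Measure Z) [SigmaFinite P] (e : κ ≃ ι) :
    MeasurePreserving (fun (z : ι → Z) k => z (e k)) (Measure.pi fun _ : ι => P)
      (Measure.pi fun _ : κ => P) :=
  (measurePreserving_piCongrLeft (α := fun _ : ι => Z) (fun _ => P) e).symm

lemma IsMeasurableClass.aemeasurable_iSup {Z ι : Type*} [MeasurableSpace Z] [Fintype ι]
    {P : Measure Z} [SigmaFinite P] {G : Set (Z → ℝ)} (hG : IsMeasurableClass P G) (e : ι → ℝ) :
    AEMeasurable (fun z : ι → Z => ⨆ g : G, |∑ i, e i * g.1 (z i)|)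
      (Measure.pi fun _ : ι => P) := by
  set τ := (Fintype.equivFin ι).symm
  have h := (hG.2 _ (e ∘ τ)).comp_quasiMeasurePreserving
    (measurePreserving_pi_comp_equiv P τ).quasiMeasurePreserving
  refine h.congr (ae_of_all _ fun z => ?_)
  simp only [Function.comp_apply]
  exact iSup_congr fun g => by rw [← Equiv.sum_comp τ]

lemma abs_sum_sign_mul_le {ι : Type*} [Fintype ι] {s : ι → ℝ} (hs : ∀ i, s i = 1 ∨ s i = -1)
    {M : ℝ} {v : ι → ℝ} (hv : ∀ i, v i ∈ Set.Icc 0 M) :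
    |∑ i, s i * v i| ≤ Fintype.card ι * M := by
  refine (Finset.abs_sum_le_sum_abs _ _).trans ?_
  refine (Finset.sum_le_card_nsmul _ _ M fun i _ => ?_).trans (by simp)
  rcases hs i with h | h <;> rw [h] <;> simpa [abs_of_nonneg (hv i).1] using (hv i).2

section

variable {Z : Type*} {G : Set (Z → ℝ)} {M : ℝ}

/-- `Φ` bounds the number of traces that any strict superlevel sets, at a common level, of members
of `G` leave on `N` points. -/
def LevelTraceBound (G : Set (Z → ℝ)) (N : ℕ) (Φ : ℝ) : Prop :=
  ∀ (ι : Type) [Fintype ι] (z : ι → Z) (T : ℝ) (𝒜 : Finset (Finset ι)), Fintype.card ι = N →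
    (∀ a ∈ 𝒜, ∃ g ∈ G, ∀ i, i ∈ a ↔ T < g (z i)) → (𝒜.card : ℝ) ≤ Φ

/-- The supremum need not be attained, so each permutation selects its own `η`-maximizer, and `η →
0` at the end. Moving the permutation from the points to the signs keeps the points fixed, so one
trace bound serves all permutations. -/
lemma sum_perm_exp_iSup_le (hGne : G.Nonempty) {ι : Type} [Fintype ι] [DecidableEq ι]
    {s : ι → ℝ} (hs : ∀ i, s i = 1 ∨ s i = -1) (h0 : ∑ i, s i = 0) {n : ℕ} (hn : 0 < n)
    (hcard : Fintype.card ι = 2 * n) (hM : 0 < M) (hGM : ∀ g ∈ G, ∀ z, g z ∈ Set.Icc 0 M)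
    {Φ : ℝ} (hΦ : LevelTraceBound G (2 * n) Φ) (z : ι → Z) {t : ℝ} (ht : 0 ≤ t) :
    ∑ σ : Equiv.Perm ι, Real.exp (t * ⨆ g : G, |∑ i, s i * g.1 (z (σ.symm i))|) ≤
      Φ * (2 * ((Fintype.card ι).factorial * Real.exp ((t * M) ^ 2 * (n + 1) / 4))) := by
  have : Nonempty G := hGne.to_subtype
  set C := Φ * (2 * ((Fintype.card ι).factorial * Real.exp ((t * M) ^ 2 * (n + 1) / 4)))
  have hη (η : ℝ) (hη : 0 < η) :
      ∑ σ : Equiv.Perm ι, Real.exp (t * ⨆ g : G, |∑ i, s i * g.1 (z (σ.symm i))|) ≤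
        Real.exp (t * η) * C := by
    have hex (σ : Equiv.Perm ι) : ∃ g : G, (⨆ g : G, |∑ i, s i * g.1 (z (σ.symm i))|) - η <
        |∑ i, s i * g.1 (z (σ.symm i))| := exists_lt_of_lt_ciSup (by linarith)
    choose g hg using hex
    have hmain := sum_perm_exp_abs_sum_mul_le s hs h0 hn hcard hM
      ((fun (g : Z → ℝ) i => g (z i)) '' G)
      (by rintro _ ⟨g, hg, rfl⟩ i; exact hGM g hg _) Φ
      (fun T 𝒜 h𝒜 => hΦ ι z T 𝒜 hcard fun a ha => by
        obtain ⟨_, ⟨g, hg, rfl⟩, h⟩ := h𝒜 a ha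
        exact ⟨g, hg, h⟩)
      (fun σ i => (g σ).1 (z i)) (fun σ => ⟨_, (g σ).2, rfl⟩) ht
    refine le_trans ?_ (mul_le_mul_of_nonneg_left hmain (Real.exp_pos _).le)
    rw [Finset.mul_sum]
    refine Finset.sum_le_sum fun σ _ => ?_
    rw [← Real.exp_add, ← mul_add]
    refine Real.exp_le_exp.2 (mul_le_mul_of_nonneg_left ?_ ht)
    have e : ∑ i, s (σ i) * (g σ).1 (z i) = ∑ i, s i * (g σ).1 (z (σ.symm i)) := by
      rw [← Equiv.sum_comp σ fun i => s i * (g σ).1 (z (σ.symm i))]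
      simp
    rw [e]
    linarith [hg σ]
  have hlim : Filter.Tendsto (fun η : ℝ => Real.exp (t * η) * C) (nhdsWithin 0 (Set.Ioi 0))
      (nhds C) := by
    have : Continuous fun η : ℝ => Real.exp (t * η) * C := by fun_prop
    simpa using (this.tendsto 0).mono_left nhdsWithin_le_nhds
  exact ge_of_tendsto hlim (by filter_upwards [self_mem_nhdsWithin] with η h using hη η h)

variable [MeasurableSpace Z] {P : Measure Z} [IsProbabilityMeasure P]

/-- The product law is invariant under permuting coordinates, so the integrand may be replaced by
its average over permutations, which is bounded pointwise. -/
lemma lintegral_exp_iSup_le (hGne : G.Nonempty) (hG : IsMeasurableClass P G)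
    {ι : Type} [Fintype ι] {s : ι → ℝ} (hs : ∀ i, s i = 1 ∨ s i = -1) (h0 : ∑ i, s i = 0)
    {n : ℕ} (hn : 0 < n) (hcard : Fintype.card ι = 2 * n) (hM : 0 < M)
    (hGM : ∀ g ∈ G, ∀ z, g z ∈ Set.Icc 0 M) {Φ : ℝ} (hΦ : LevelTraceBound G (2 * n) Φ)
    {t : ℝ} (ht : 0 ≤ t) :
    ∫⁻ z, ENNReal.ofReal (Real.exp (t * ⨆ g : G, |∑ i, s i * g.1 (z i)|))
      ∂(Measure.pi fun _ : ι => P) ≤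
      ENNReal.ofReal (2 * Φ * Real.exp ((t * M) ^ 2 * (n + 1) / 4)) := by
  classical
  set Q : Measure (ι → Z) := Measure.pi fun _ : ι => P with hQ
  set H : (ι → Z) → ENNReal := fun z =>
    ENNReal.ofReal (Real.exp (t * ⨆ g : G, |∑ i, s i * g.1 (z i)|)) with hH
  have hHm : AEMeasurable H Q :=
    (Real.measurable_exp.comp_aemeasurable
      ((hG.aemeasurable_iSup s).const_mul t)).ennreal_ofReal
  have hmp (σ : Equiv.Perm ι) : MeasurePreserving (fun (z : ι → Z) i => z (σ.symm i)) Q Q :=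
    measurePreserving_pi_comp_equiv P σ.symm
  have hinv (σ : Equiv.Perm ι) : ∫⁻ z, H (fun i => z (σ.symm i)) ∂Q = ∫⁻ z, H z ∂Q := by
    have h := lintegral_map' (μ := Q) (g := fun (z : ι → Z) i => z (σ.symm i))
      (by rw [(hmp σ).map_eq]; exact hHm) (hmp σ).measurable.aemeasurable
    rw [(hmp σ).map_eq] at h
    exact h.symm
  have hfac : ((Fintype.card ι).factorial : ENNReal) ≠ 0 := by
    exact_mod_cast Nat.factorial_ne_zero _
  refine (ENNReal.mul_le_mul_iff_right hfac (ENNReal.natCast_ne_top _)).1 ?_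
  calc ((Fintype.card ι).factorial : ENNReal) * ∫⁻ z, H z ∂Q
      = ∑ σ : Equiv.Perm ι, ∫⁻ z, H (fun i => z (σ.symm i)) ∂Q := by
        simp_rw [hinv]; simp [Fintype.card_perm]
    _ = ∫⁻ z, ∑ σ : Equiv.Perm ι, H (fun i => z (σ.symm i)) ∂Q :=
        (lintegral_finsetSum' _ fun σ _ =>
          hHm.comp_quasiMeasurePreserving (hmp σ).quasiMeasurePreserving).symm
    _ ≤ ∫⁻ z, ENNReal.ofReal (Φ * (2 * ((Fintype.card ι).factorial *
          Real.exp ((t * M) ^ 2 * (n + 1) / 4)))) ∂Q := by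
        refine lintegral_mono fun z => ?_
        rw [← ENNReal.ofReal_sum_of_nonneg fun _ _ => (Real.exp_pos _).le]
        exact ENNReal.ofReal_le_ofReal
          (sum_perm_exp_iSup_le hGne hs h0 hn hcard hM hGM hΦ z ht)
    _ = _ := by
        rw [lintegral_const, measure_univ, mul_one, ← ENNReal.ofReal_natCast,
          ← ENNReal.ofReal_mul (by positivity)]
        congr 1; ring

/-- Provides a measurable integrand for Tonelli that dominates everywhere, so that later bounds hold
for every sample and not just almost every one. -/
lemma exists_measurable_ge_ae_eq {α : Type*} [MeasurableSpace α] {ν : Measure α}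
    {f : α → ENNReal} (hf : AEMeasurable f ν) :
    ∃ k : α → ENNReal, Measurable k ∧ f ≤ k ∧ k =ᵐ[ν] f := by
  classical
  set N := toMeasurable ν {x | f x ≠ hf.mk f x}
  have hN : ν N = 0 := by rw [measure_toMeasurable]; exact hf.ae_eq_mk
  have hNm : MeasurableSet N := measurableSet_toMeasurable _ _
  refine ⟨N.piecewise (fun _ => ⊤) (hf.mk f), measurable_const.piecewise hNm hf.measurable_mk,
    fun x => ?_, ?_⟩
  · by_cases hx : x ∈ N
    · simp [hx]
    · have : f x = hf.mk f x := by
        by_contra h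
        exact hx (subset_toMeasurable _ _ h)
      simp [hx, this]
  · have : ∀ᵐ x ∂ν, x ∉ N := measure_eq_zero_iff_ae_notMem.1 hN
    filter_upwards [this, hf.ae_eq_mk] with x hx hx'
    simp [hx, hx']

/-- Symmetrized uniform deviation bound, with a measurable exceptional set. -/
lemma exists_measurableSet_deviation (hGne : G.Nonempty) (hG : IsMeasurableClass P G)
    {n : ℕ} (hn : 0 < n) (hM : 0 < M) (hGM : ∀ g ∈ G, ∀ z, g z ∈ Set.Icc 0 M) {Φ : ℝ}
    (hΦ : LevelTraceBound G (2 * n) Φ) {t : ℝ} (ht : 0 ≤ t) (c : ℝ) :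
    ∃ B : Set (Fin n → Z), MeasurableSet B ∧
      (Measure.pi fun _ : Fin n => P) B ≤
        ENNReal.ofReal (2 * Φ * Real.exp ((t * M) ^ 2 * (n + 1) / 4 - t * c)) ∧
      ∀ z ∉ B, ∀ g ∈ G, t * |∑ k, g (z k) - n * ∫ x, g x ∂P| ≤ t * c := by
  set Q : Measure (Fin n → Z) := Measure.pi fun _ : Fin n => P with hQ
  set s : Fin n ⊕ Fin n → ℝ := Sum.elim (fun _ => 1) (fun _ => -1) with hsdef
  have hs : ∀ i, s i = 1 ∨ s i = -1 := by rintro (i | i) <;> simp [hsdef]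
  have h0 : ∑ i, s i = 0 := by simp [hsdef]
  have hcard : Fintype.card (Fin n ⊕ Fin n) = 2 * n := by simp [two_mul]
  have hHm : AEMeasurable (fun z : Fin n ⊕ Fin n → Z =>
      ENNReal.ofReal (Real.exp (t * ⨆ g : G, |∑ i, s i * g.1 (z i)|)))
      (Measure.pi fun _ : Fin n ⊕ Fin n => P) :=
    (Real.measurable_exp.comp_aemeasurable
      ((hG.aemeasurable_iSup s).const_mul t)).ennreal_ofReal
  obtain ⟨K, hKm, hHK, hKae⟩ := exists_measurable_ge_ae_eq hHm
  have hK := lintegral_exp_iSup_le hGne hG hs h0 hn hcard hM hGM hΦ ht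
  rw [← lintegral_congr_ae hKae] at hK
  have hmp := measurePreserving_sumPiEquivProdPi_symm
    (X := fun _ : Fin n ⊕ Fin n => Z) (fun _ => P)
  rw [← hmp.lintegral_comp hKm] at hK
  have hKm' : Measurable fun p : (Fin n → Z) × (Fin n → Z) =>
      K ((MeasurableEquiv.sumPiEquivProdPi fun _ : Fin n ⊕ Fin n => Z).symm p) :=
    hKm.comp (MeasurableEquiv.measurable _)
  rw [lintegral_prod _ hKm'.aemeasurable] at hK
  set W : (Fin n → Z) → ENNReal := fun z =>
    ∫⁻ z', K ((MeasurableEquiv.sumPiEquivProdPi fun _ : Fin n ⊕ Fin n => Z).symm (z, z')) ∂Q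
    with hW
  have hWm : Measurable W := hKm'.lintegral_prod_right'
  -- Jensen over the ghost sample `z'`, whose sum has mean `n * ∫ x, g x ∂P`. `W` does not depend on
  -- `g`, so Markov's inequality for `W` handles all `g` at once.
  have hWge (z : Fin n → Z) (g : Z → ℝ) (hg : g ∈ G) :
      ENNReal.ofReal (Real.exp (t * |∑ k, g (z k) - n * ∫ x, g x ∂P|)) ≤ W z := by
    have hgm : Measurable g := hG.1 g hg
    have hgi : Integrable g P := Integrable.of_mem_Icc 0 M hgm.aemeasurable
      (ae_of_all _ fun x => hGM g hg x)
    have hXm : Measurable fun z' : Fin n → Z => ∑ k, g (z k) - ∑ k, g (z' k) := by fun_prop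
    have hX (z' : Fin n → Z) : ∑ k, g (z k) - ∑ k, g (z' k) = ∑ i, s i *
        g ((MeasurableEquiv.sumPiEquivProdPi fun _ : Fin n ⊕ Fin n => Z).symm (z, z') i) := by
      rw [Fintype.sum_sum_type]
      simp only [hsdef, Sum.elim_inl, Sum.elim_inr, one_mul, neg_mul, Finset.sum_neg_distrib,
        ← sub_eq_add_neg]
      rfl
    have hXb (z' : Fin n → Z) : |∑ k, g (z k) - ∑ k, g (z' k)| ≤ 2 * n * M := by
      rw [hX]
      refine (abs_sum_sign_mul_le hs fun i => hGM g hg _).trans_eq ?_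
      rw [hcard]; push_cast; rfl
    have hint : ∫ z', (∑ k, g (z k) - ∑ k, g (z' k)) ∂Q = ∑ k, g (z k) - n * ∫ x, g x ∂P := by
      have hi (k : Fin n) : Integrable (fun z' : Fin n → Z => g (z' k)) Q :=
        (measurePreserving_eval (fun _ : Fin n => P) k).integrable_comp_of_integrable hgi
      rw [integral_sub (integrable_const _) (integrable_finsetSum _ fun k _ => hi k),
        integral_finsetSum _ fun k _ => hi k]
      have (k : Fin n) : ∫ z' : Fin n → Z, g (z' k) ∂Q = ∫ x, g x ∂P := by
        have := (measurePreserving_eval (fun _ : Fin n => P) k)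
        rw [← this.map_eq, integral_map this.measurable.aemeasurable
          (by rw [this.map_eq]; exact hgi.aestronglyMeasurable)]
      simp [this]
    obtain ⟨hI, hJ⟩ := exp_mul_abs_integral_le (ν := Q) hXm.aemeasurable hXb ht
    rw [hint] at hJ
    refine (ENNReal.ofReal_le_ofReal hJ).trans ?_
    rw [ofReal_integral_eq_lintegral_ofReal hI (ae_of_all _ fun _ => (Real.exp_pos _).le)]
    refine lintegral_mono fun z' => le_trans ?_ (hHK _)
    refine ENNReal.ofReal_le_ofReal (Real.exp_le_exp.2 (mul_le_mul_of_nonneg_left ?_ ht))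
    rw [hX]
    refine le_ciSup (f := fun g : G => |∑ i, s i * g.1 ((MeasurableEquiv.sumPiEquivProdPi
      fun _ : Fin n ⊕ Fin n => Z).symm (z, z') i)|) ⟨Fintype.card (Fin n ⊕ Fin n) * M, ?_⟩ ⟨g, hg⟩
    rintro _ ⟨g', rfl⟩
    exact abs_sum_sign_mul_le hs fun i => hGM g'.1 g'.2 _
  have hexp : ENNReal.ofReal (Real.exp (t * c)) ≠ 0 := by simp [Real.exp_pos]
  refine ⟨{z | ENNReal.ofReal (Real.exp (t * c)) ≤ W z}, measurableSet_le measurable_const hWm,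
    ?_, fun z hz g hg => ?_⟩
  · refine (meas_ge_le_lintegral_div hWm.aemeasurable hexp ENNReal.ofReal_ne_top).trans ?_
    refine (ENNReal.div_le_div_right hK _).trans_eq ?_
    rw [← ENNReal.ofReal_div_of_pos (Real.exp_pos _), Real.exp_sub, mul_div_assoc]
  · have h := (hWge z g hg).trans (not_le.1 hz).le
    rw [ENNReal.ofReal_le_ofReal_iff (Real.exp_pos _).le] at h
    exact Real.exp_le_exp.1 h

end

/-! ### The Vapnik-Chervonenkis inequality -/

/-- A trace at level `T` is the trace of a subgraph on the points `(z i, T)`. -/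
lemma levelTraceBound_of_funVCDim_le {Z : Type*} {G : Set (Z → ℝ)} {N d : ℕ} (hd : d ≤ N)
    (hG : funVCDim G ≤ d) : LevelTraceBound G N ((Real.exp 1 * N / d) ^ d) := by
  classical
  intro ι _ z T 𝒜 hι h𝒜
  refine le_trans ?_ (sum_choose_le_exp_mul_div_pow hd)
  rw [← hι]
  refine Nat.cast_le.2 (card_le_sum_choose_of_vcDim_le hG (fun i => (z i, T)) 𝒜 fun a ha => ?_)
  obtain ⟨g, hg, h⟩ := h𝒜 a ha
  exact ⟨_, ⟨g, hg, rfl⟩, h⟩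

/-- With two labels, the set `{f = y₁}` determines `f` on the sample, hence the losses and their
level traces; so there are no more level traces than classical ones. -/
lemma levelTraceBound_of_binary {X Y : Type*} (ℓ : Y → Y → ℝ) {F : Set (X → Y)} {N d : ℕ}
    (hd : d ≤ N) {y₀ y₁ : Y} (hY : ∀ y, y = y₀ ∨ y = y₁)
    (hF : vcDim ((fun f : X → Y => {x | f x = y₁}) '' F) ≤ d) :
    LevelTraceBound (lossClass ℓ F) N ((Real.exp 1 * N / d) ^ d) := by
  classical
  intro ι _ z T 𝒜 hι h𝒜
  refine le_trans ?_ (sum_choose_le_exp_mul_div_pow hd)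
  rw [← hι]
  have hex : ∀ a : 𝒜, ∃ f ∈ F, ∀ i, i ∈ a.1 ↔ T < ℓ (f (z i).1) (z i).2 := by
    rintro ⟨a, ha⟩
    obtain ⟨_, ⟨f, hf, rfl⟩, h⟩ := h𝒜 a ha
    exact ⟨f, hf, h⟩
  choose f hfF hf using hex
  set b : 𝒜 → Finset ι := fun a => Finset.univ.filter fun i => f a (z i).1 = y₁ with hb
  have hinj : Function.Injective b := by
    intro a a' h
    have hfa (i : ι) : f a (z i).1 = f a' (z i).1 := by
      have hi : f a (z i).1 = y₁ ↔ f a' (z i).1 = y₁ := by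
        simpa [hb] using Finset.ext_iff.1 h i
      rcases hY (f a (z i).1) with h1 | h1 <;> rcases hY (f a' (z i).1) with h2 | h2
      · rw [h1, h2]
      · rw [hi.2 h2, h2]
      · rw [h1, hi.1 h1]
      · rw [h1, h2]
    ext i
    rw [hf a, hf a', hfa]
  have hcard : 𝒜.card = (Finset.univ.image b).card := by
    rw [Finset.card_image_of_injective _ hinj]; simp
  rw [hcard]
  refine Nat.cast_le.2 (card_le_sum_choose_of_vcDim_le hF (fun i => (z i).1) _ fun a ha => ?_)
  obtain ⟨a, -, rfl⟩ := Finset.mem_image.1 ha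
  exact ⟨_, ⟨f a, hfF a, rfl⟩, fun i => by simp [hb]⟩

/-- **Vapnik-Chervonenkis inequality** for a class of functions with values in `[0, M]`. -/
lemma exists_measurableSet_abs_mean_sub_integral_le {Z : Type*} [MeasurableSpace Z]
    {P : Measure Z} [IsProbabilityMeasure P] {G : Set (Z → ℝ)} (hGne : G.Nonempty)
    (hG : IsMeasurableClass P G) {n : ℕ} (hn : 0 < n) {M : ℝ} (hM : 0 < M)
    (hGM : ∀ g ∈ G, ∀ z, g z ∈ Set.Icc 0 M) {Φ : ℝ} (hΦ0 : 0 ≤ Φ)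
    (hΦ : LevelTraceBound G (2 * n) Φ) {ε : ℝ} (hε : 0 < ε) :
    ∃ B : Set (Fin n → Z), MeasurableSet B ∧
      (Measure.pi fun _ : Fin n => P) B ≤
        ENNReal.ofReal (8 * Φ * Real.exp (-(n * (ε / M) ^ 2))) ∧
      ∀ z ∉ B, ∀ g ∈ G, |1 / (n : ℝ) * ∑ k, g (z k) - ∫ x, g x ∂P| ≤ ε := by
  have hn' : (0 : ℝ) < n := by exact_mod_cast hn
  rcases le_or_gt ε M with hεM | hεM
  -- This `t` minimizes `(t M)² n / 4 - t n ε`. The extra `1` in `n + 1` costs `exp ((ε/M)²) ≤ e`,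
  -- and `2e ≤ 8`.
  · have ht : 0 < 2 * ε / M ^ 2 := by positivity
    obtain ⟨B, hBm, hB, hdev⟩ := exists_measurableSet_deviation hGne hG hn hM hGM hΦ ht.le (n * ε)
    refine ⟨B, hBm, hB.trans (ENNReal.ofReal_le_ofReal ?_), fun z hz g hg => ?_⟩
    · have hr : (ε / M) ^ 2 ≤ 1 := pow_le_one₀ (by positivity) ((div_le_one hM).2 hεM)
      have he : (2 * ε / M ^ 2 * M) ^ 2 * (n + 1) / 4 - 2 * ε / M ^ 2 * (n * ε) ≤
          1 + -(n * (ε / M) ^ 2) := by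
        have : (2 * ε / M ^ 2 * M) ^ 2 * (n + 1) / 4 - 2 * ε / M ^ 2 * (n * ε) =
            (ε / M) ^ 2 + -(n * (ε / M) ^ 2) := by
          field_simp
          ring
        linarith
      calc 2 * Φ * Real.exp ((2 * ε / M ^ 2 * M) ^ 2 * (n + 1) / 4 - 2 * ε / M ^ 2 * (n * ε))
          ≤ 2 * Φ * Real.exp (1 + -(n * (ε / M) ^ 2)) := by gcongr
        _ = (2 * Real.exp 1) * (Φ * Real.exp (-(n * (ε / M) ^ 2))) := by rw [Real.exp_add]; ring
        _ ≤ 8 * (Φ * Real.exp (-(n * (ε / M) ^ 2))) := by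
            gcongr
            linarith [Real.exp_one_lt_d9]
        _ = _ := by ring
    · have h := le_of_mul_le_mul_left (hdev z hz g hg) ht
      have e : 1 / (n : ℝ) * ∑ k, g (z k) - ∫ x, g x ∂P =
          (∑ k, g (z k) - n * ∫ x, g x ∂P) / n := by field_simp
      rw [e, abs_div, abs_of_pos hn', div_le_iff₀ hn']
      linarith
  -- Both means lie in `[0, M]`, so a deviation above `M` is impossible.
  · refine ⟨∅, MeasurableSet.empty, by simp, fun z _ g hg => ?_⟩
    have hgi : Integrable g P := Integrable.of_mem_Icc 0 M (hG.1 g hg).aemeasurable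
      (ae_of_all _ fun x => hGM g hg x)
    have h1 : ∫ x, g x ∂P ∈ Set.Icc 0 M := by
      refine ⟨integral_nonneg fun x => (hGM g hg x).1, ?_⟩
      simpa using integral_mono hgi (integrable_const M) fun x => (hGM g hg x).2
    have h2 : 1 / (n : ℝ) * ∑ k, g (z k) ∈ Set.Icc 0 M := by
      have hs : ∑ k, g (z k) ≤ n * M :=
        (Finset.sum_le_card_nsmul _ _ M fun k _ => (hGM g hg _).2).trans (by simp)
      refine ⟨mul_nonneg (by positivity) (Finset.sum_nonneg fun k _ => (hGM g hg _).1), ?_⟩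
      rw [one_div, inv_mul_le_iff₀ hn']
      exact hs
    rw [abs_le]
    constructor <;> linarith [h1.1, h1.2, h2.1, h2.2]

lemma exp_mul_log_eq_pow {n d : ℕ} (hn : 0 < n) :
    Real.exp (d * Real.log (2 * Real.exp 1 * n / d)) = (Real.exp 1 * (2 * n : ℕ) / d) ^ d := by
  rcases Nat.eq_zero_or_pos d with rfl | hd
  · simp
  · have hn' : (0 : ℝ) < n := by exact_mod_cast hn
    have hd' : (0 : ℝ) < d := by exact_mod_cast hd
    rw [Real.exp_nat_mul, Real.exp_log (by positivity)]
    push_cast; ring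

lemma one_le_exp_mul_div_pow {N d : ℕ} (hd : d ≤ N) : 1 ≤ (Real.exp 1 * N / d) ^ d := by
  refine le_trans ?_ (sum_choose_le_exp_mul_div_pow hd)
  have : N.choose 0 ≤ ∑ k ∈ Finset.range (d + 1), N.choose k :=
    Finset.single_le_sum (f := fun k => N.choose k) (fun _ _ => Nat.zero_le _) (by simp)
  rw [Nat.choose_zero_right] at this
  exact_mod_cast this

end FairnessVC

/-! ### Union bound over the groups -/

theorem mainTheorem2 {X Y A Ω : Type*} [MeasurableSpace X] [MeasurableSpace Y] [Fintype A]
    [MeasurableSpace Ω] (μ : Measure Ω) [IsProbabilityMeasure μ]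
    -- the bounded loss and the function class
    (M : ℝ) (ℓ : Y → Y → ℝ) (hℓ : ∀ y y', ℓ y y' ∈ Set.Icc 0 M) (F : Set (X → Y))
    -- the data distributions of the groups
    (D : A → Measure (X × Y)) [∀ a, IsProbabilityMeasure (D a)]
    (hmeas : ∀ a, FairnessVC.IsMeasurableClass (D a) (FairnessVC.lossClass ℓ F))
    (n d : ℕ) (hn : 0 < n) (hdn : d ≤ 2 * n)
    -- `d` is the VC dimension of the class composed with the loss, or, in the case of binary
    -- outputs, the classical VC dimension of the class itself
    (hd : FairnessVC.funVCDim (FairnessVC.lossClass ℓ F) = (d : ℕ∞) ∨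
      ∃ y₀ y₁ : Y, y₀ ≠ y₁ ∧ (∀ y, y = y₀ ∨ y = y₁) ∧
        FairnessVC.vcDim ((fun f : X → Y => {x | f x = y₁}) '' F) = (d : ℕ∞))
    -- for each group an i.i.d. sample of size `n`
    (S : A → Fin n → Ω → X × Y) (hlaw : ∀ a k, HasLaw (S a k) (D a) μ)
    (hindep : ∀ a, iIndepFun (S a) μ)
    (δ : ℝ) (hδ : 0 < δ) :
    ∃ E : Set Ω, MeasurableSet E ∧ 1 - δ ≤ μ.real E ∧
      ∀ ω ∈ E, ∀ f ∈ F, ∀ i j : A,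
        |FairnessVC.risk ℓ (D i) f - FairnessVC.risk ℓ (D j) f| ≤
          |FairnessVC.empRisk ℓ (fun k => S i k ω) f - FairnessVC.empRisk ℓ (fun k => S j k ω) f| +
            2 * M * √((2 * d * Real.log (2 * Real.exp 1 * n / d) +
              Real.log (8 * (Fintype.card A : ℝ) ^ 2 / δ)) / n) := by
  classical
  rcases isEmpty_or_nonempty A with hA | hA
  · exact ⟨Set.univ, MeasurableSet.univ, by simp [hδ.le], fun ω _ f _ i => hA.elim i⟩
  rcases F.eq_empty_or_nonempty with rfl | hF
  · exact ⟨Set.univ, MeasurableSet.univ, by simp [hδ.le], fun ω _ f hf => hf.elim⟩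
  rcases le_or_gt 1 δ with hδ1 | hδ1
  · exact ⟨∅, MeasurableSet.empty, by simpa using hδ1, fun ω hω => hω.elim⟩
  have hn' : (0 : ℝ) < n := by exact_mod_cast hn
  have hM0 : 0 ≤ M := by
    obtain ⟨z⟩ := nonempty_of_isProbabilityMeasure (D hA.some)
    exact (hℓ z.2 z.2).1.trans (hℓ z.2 z.2).2
  rcases hM0.eq_or_lt with rfl | hM
  · have h0 (y y' : Y) : ℓ y y' = 0 := le_antisymm (hℓ y y').2 (hℓ y y').1
    refine ⟨Set.univ, MeasurableSet.univ, by simp [hδ.le], fun ω _ f _ i j => ?_⟩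
    simp [FairnessVC.risk, FairnessVC.empRisk, h0]
  set Φ : ℝ := (Real.exp 1 * (2 * n : ℕ) / d) ^ d with hΦdef
  set G := FairnessVC.lossClass ℓ F with hGdef
  have hΦ : FairnessVC.LevelTraceBound G (2 * n) Φ := by
    rcases hd with hd | ⟨y₀, y₁, -, hY, hd⟩
    · exact FairnessVC.levelTraceBound_of_funVCDim_le hdn hd.le
    · exact FairnessVC.levelTraceBound_of_binary ℓ hdn hY hd.le
  have hΦ1 : 1 ≤ Φ := FairnessVC.one_le_exp_mul_div_pow hdn
  have hΦ0 : 0 < Φ := by linarith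
  have hGne : G.Nonempty := hF.image _
  have hGM : ∀ g ∈ G, ∀ z, g z ∈ Set.Icc 0 M := by
    rintro _ ⟨f, -, rfl⟩ z
    exact hℓ _ _
  set a : ℝ := ((Fintype.card A : ℕ) : ℝ) with ha
  have ha1 : 1 ≤ a := by rw [ha]; exact_mod_cast Fintype.card_pos
  have hL : Real.exp (d * Real.log (2 * Real.exp 1 * n / d)) = Φ :=
    FairnessVC.exp_mul_log_eq_pow hn
  have hL0 : 0 ≤ d * Real.log (2 * Real.exp 1 * n / d) := by
    rw [← Real.exp_le_exp, Real.exp_zero, hL]; exact hΦ1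
  have hq : 1 < 8 * a ^ 2 / δ := by
    rw [lt_div_iff₀ hδ]; nlinarith
  set R : ℝ := 2 * d * Real.log (2 * Real.exp 1 * n / d) + Real.log (8 * a ^ 2 / δ) with hR
  have hR0 : 0 < R := by
    have := Real.log_pos hq
    rw [hR]; linarith
  -- In fact `8 Φ exp (-R) = δ / (Φ a²)`; the surplus factors `Φ` and `a` are discarded.
  have hexpR : 8 * Φ * Real.exp (-R) ≤ δ / a := by
    have : Real.exp R = Φ ^ 2 * (8 * a ^ 2 / δ) := by
      rw [hR, Real.exp_add, Real.exp_log (by linarith), mul_assoc, ← hL, ← Real.exp_nat_mul]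
      norm_num
    rw [Real.exp_neg, this, ← div_eq_mul_inv, div_le_div_iff₀ (by positivity) (by positivity)]
    calc 8 * Φ * a ≤ 8 * (Φ * Φ) * (a * a) := by
          have h1 : Φ ≤ Φ * Φ := by nlinarith
          have h2 : a ≤ a * a := by nlinarith
          gcongr
      _ = δ * (Φ ^ 2 * (8 * a ^ 2 / δ)) := by field_simp
  set ε : ℝ := M * √(R / n) with hεdef
  have hε : 0 < ε := by positivity
  have hεR : (n : ℝ) * (ε / M) ^ 2 = R := by
    rw [hεdef, mul_div_cancel_left₀ _ hM.ne', Real.sq_sqrt (by positivity)]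
    field_simp
  have hB (i : A) := FairnessVC.exists_measurableSet_abs_mean_sub_integral_le
    hGne (hmeas i) hn hM hGM hΦ0.le hΦ hε
  choose B hBm hBP hBdev using hB
  have hvec (i : A) : AEMeasurable (fun ω k => S i k ω) μ :=
    aemeasurable_pi_lambda _ fun k => (hlaw i k).aemeasurable
  have hmap (i : A) : μ.map (fun ω k => S i k ω) = Measure.pi fun _ : Fin n => D i := by
    rw [(iIndepFun_iff_map_fun_eq_pi_map fun k => (hlaw i k).aemeasurable).1 (hindep i)]
    simp_rw [(hlaw i _).map_eq]
  have hbad : μ (⋃ i, (fun ω k => S i k ω) ⁻¹' B i) ≤ ENNReal.ofReal δ := by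
    calc μ (⋃ i, (fun ω k => S i k ω) ⁻¹' B i)
        ≤ ∑ i, μ ((fun ω k => S i k ω) ⁻¹' B i) := measure_iUnion_fintype_le _ _
      _ ≤ ∑ _i : A, ENNReal.ofReal (δ / a) := by
          refine Finset.sum_le_sum fun i _ => ?_
          rw [← Measure.map_apply_of_aemeasurable (hvec i) (hBm i), hmap]
          refine (hBP i).trans (ENNReal.ofReal_le_ofReal ?_)
          rw [hεR]
          exact hexpR
      _ = ENNReal.ofReal δ := by
          rw [Finset.sum_const, Finset.card_univ, nsmul_eq_mul, ← ENNReal.ofReal_natCast,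
            ← ENNReal.ofReal_mul (by positivity), mul_div_cancel₀ _ (by linarith : a ≠ 0)]
  -- The samples are only a.e. measurable, so the bad event is enlarged to a measurable set of equal
  -- measure.
  refine ⟨(toMeasurable μ (⋃ i, (fun ω k => S i k ω) ⁻¹' B i))ᶜ,
    (measurableSet_toMeasurable _ _).compl, ?_, fun ω hω f hf i j => ?_⟩
  · rw [measureReal_compl (measurableSet_toMeasurable _ _), probReal_univ]
    have : μ.real (toMeasurable μ (⋃ i, (fun ω k => S i k ω) ⁻¹' B i)) ≤ δ := by
      rw [measureReal_def, measure_toMeasurable]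
      exact ENNReal.toReal_le_of_le_ofReal hδ.le hbad
    linarith
  · have hdev (i : A) : |FairnessVC.empRisk ℓ (fun k => S i k ω) f -
        FairnessVC.risk ℓ (D i) f| ≤ ε := by
      refine hBdev i (fun k => S i k ω) (fun h => hω ?_) _ ⟨f, hf, rfl⟩
      exact subset_toMeasurable _ _ (Set.mem_iUnion.2 ⟨i, h⟩)
    have h1 := abs_le.1 (hdev i)
    have h2 := abs_le.1 (hdev j)
    have e : 2 * M * √(R / n) = 2 * ε := by rw [hεdef]; ring
    rw [e, abs_le]
    have h3 := le_abs_self (FairnessVC.empRisk ℓ (fun k => S i k ω) f -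
      FairnessVC.empRisk ℓ (fun k => S j k ω) f)
    have h4 := neg_abs_le (FairnessVC.empRisk ℓ (fun k => S i k ω) f -
      FairnessVC.empRisk ℓ (fun k => S j k ω) f)
    constructor <;> linarith [h1.1, h1.2, h2.1, h2.2]
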